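/- For an $m\times n$ real matrix $\mathbf A$ with columns $\mathbf a_1,\dots,\mathbf a_n$ and $S\subseteq\{1,\dots,n\}$, let $\mathrm{Er}_{\mathbf A}(S)=\|\mathbf A-\mathbf P_S\mathbf A\|_F^2$, where $\mathbf P_S$ is the orthogonal projection onto $\mathrm{span}\{\mathbf a_i: i\in S\}$, and let $\mathrm{OPT}_k=\min_{\mathbf B:\,\mathrm{rank}(\mathbf B)=k}\|\mathbf A-\mathbf B\|_F^2$, where $\mathbf B$ ranges over real $m\times n$ matrices. For every $t\in\mathbb N$ and $\delta\in(0,1)$ there are integers $0<k_1^l<k_1^u<k_2^l<k_2^u<\dots<k_t^l<k_t^u$ and a matrix $\mathbf A\in\mathbb R^{m\times n}$, for some $m$ and $n\ge k_t^u$, such that for every $i\in\{1,\dots,t\}$ the numbers $\mathrm{OPT}_{k_i^l}$ and $\mathrm{OPT}_{k_i^u}$ are positive and $$\min_{S:\,|S|=k_i^l}\frac{\mathrm{Er}_{\mathbf A}(S)}{\mathrm{OPT}_{k_i^l}}\le 1+\delta\qquad\text{and}\qquad \min_{S:\,|S|=k_i^u}\frac{\mathrm{Er}_{\mathbf A}(S)}{\mathrm{OPT}_{k_i^u}}\ge(1-\delta)(k_i^u+1).$$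 -/

import Mathlib

noncomputable section

namespace CSSP

section Frobenius

attribute [local instance] Matrix.frobeniusNormedAddCommGroup

/-- The squared Frobenius norm of a real matrix. -/
def frobSq {m n : ℕ} (A : Matrix (Fin m) (Fin n) ℝ) : ℝ := ‖A‖ ^ 2

end Frobenius

/-- The span of the columns of `A` with indices in `S`, in Euclidean space. -/
def colSpan {m n : ℕ} (A : Matrix (Fin m) (Fin n) ℝ) (S : Finset (Fin n)) :
    Submodule ℝ (EuclideanSpace ℝ (Fin m)) :=
  Submodule.span ℝ ((fun j => WithLp.toLp 2 (A.col j)) '' (S : Set (Fin n)))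

/-- The matrix of the orthogonal projection onto the span of the columns with indices in `S`. -/
def proj {m n : ℕ} (A : Matrix (Fin m) (Fin n) ℝ) (S : Finset (Fin n)) :
    Matrix (Fin m) (Fin m) ℝ :=
  (Matrix.toEuclideanCLM (n := Fin m) (𝕜 := ℝ)).symm (colSpan A S).starProjection

/-- The squared projection error `‖A - P_S A‖_F ^ 2` of a set of columns. -/
def Er {m n : ℕ} (A : Matrix (Fin m) (Fin n) ℝ) (S : Finset (Fin n)) : ℝ :=
  frobSq (A - proj A S * A)

/-- The best squared Frobenius error of an approximation of `A` by a matrix of rank `k`. -/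
def OPT {m n : ℕ} (A : Matrix (Fin m) (Fin n) ℝ) (k : ℕ) : ℝ :=
  sInf ((fun B : Matrix (Fin m) (Fin n) ℝ => frobSq (A - B)) '' {B | B.rank = k})

end CSSP

end

noncomputable section

namespace CSSP

open Matrix

variable {m n : ℕ}

/-! ### Projection errors and dual vectors -/

section Frobenius

attribute [local instance] Matrix.frobeniusNormedAddCommGroup

/-! Take `A` block diagonal with blocks of sizes `M ^ b`, each an orthogonal matrix containing one
row of constant modulus. Ordinary rows of block `b` are scaled to squared norm `η ^ (2b)`, the
constant row to `η ^ (2b+1)`. The rows of `A` are orthogonal, so `OPT` is a tail sum of these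
numbers (`OPT_eq_sum`).

Taking all columns of the first `c` blocks attains `OPT`: this is the good rank. One less than the
size of the first `c + 1` blocks is the bad rank: there `OPT` is about `η ^ (2c+1)`, while any
choice misses a column of these blocks. The squared distance from that column to the span of all the
others is bounded below by duality (`one_le_sum_div_mul_Er`), and the error is at least about `M ^ c
* η ^ (2c+1)` (`le_Er_scaled`). For large `M` the last block has nearly all of the `k + 1` columns,
so the ratio is nearly `k + 1`. -/

theorem frobSq_eq_sum (A : Matrix (Fin m) (Fin n) ℝ) : frobSq A = ∑ i, ∑ j, A i j ^ 2 := by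
  have h : 0 ≤ ∑ i, ∑ j, A i j ^ 2 :=
    Finset.sum_nonneg fun i _ => Finset.sum_nonneg fun j _ => sq_nonneg _
  unfold frobSq
  rw [Matrix.frobenius_norm_def]
  simp only [Real.norm_eq_abs, Real.rpow_two, sq_abs]
  rw [← Real.sqrt_eq_rpow, Real.sq_sqrt h]

end Frobenius

theorem frobSq_nonneg (A : Matrix (Fin m) (Fin n) ℝ) : 0 ≤ frobSq A := by
  rw [frobSq_eq_sum]
  positivity

theorem frobSq_eq_sum_col (A : Matrix (Fin m) (Fin n) ℝ) :
    frobSq A = ∑ j, ‖WithLp.toLp 2 (A.col j)‖ ^ 2 := by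
  rw [frobSq_eq_sum, Finset.sum_comm]
  refine Finset.sum_congr rfl fun j _ => ?_
  rw [EuclideanSpace.norm_sq_eq]
  simp [Matrix.col_apply]

theorem toLp_proj_mulVec (A : Matrix (Fin m) (Fin n) ℝ) (S : Finset (Fin n)) (v : Fin m → ℝ) :
    WithLp.toLp 2 (proj A S *ᵥ v) = (colSpan A S).starProjection (WithLp.toLp 2 v) := by
  rw [← Matrix.toEuclideanCLM_toLp (𝕜 := ℝ), proj, StarAlgEquiv.apply_symm_apply]

theorem toLp_col_mem_colSpan (A : Matrix (Fin m) (Fin n) ℝ) {S : Finset (Fin n)} {j : Fin n}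
    (hj : j ∈ S) : WithLp.toLp 2 (A.col j) ∈ colSpan A S :=
  Submodule.subset_span ⟨j, hj, rfl⟩

theorem frobSq_sub_proj_mul (A : Matrix (Fin m) (Fin n) ℝ) {l : ℕ} (C : Matrix (Fin m) (Fin l) ℝ)
    (S : Finset (Fin n)) :
    frobSq (C - proj A S * C) = ∑ j, ‖WithLp.toLp 2 (C.col j) -
      (colSpan A S).starProjection (WithLp.toLp 2 (C.col j))‖ ^ 2 := by
  rw [frobSq_eq_sum_col]
  refine Finset.sum_congr rfl fun j _ => ?_
  rw [← toLp_proj_mulVec]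
  rfl

theorem norm_sub_starProjection_le {E : Type*} [NormedAddCommGroup E] [InnerProductSpace ℝ E]
    (U : Submodule ℝ E) [U.HasOrthogonalProjection] (x : E) {y : E} (hy : y ∈ U) :
    ‖x - U.starProjection x‖ ≤ ‖x - y‖ := by
  rw [Submodule.starProjection_minimal]
  exact ciInf_le ⟨0, by rintro _ ⟨z, rfl⟩; exact norm_nonneg _⟩ (⟨y, hy⟩ : U)

/-- Projecting onto the column space of `B` approximates at least as well as `B`. -/
theorem frobSq_sub_proj_mul_le (A B : Matrix (Fin m) (Fin n) ℝ) :
    frobSq (A - proj B Finset.univ * A) ≤ frobSq (A - B) := by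
  rw [frobSq_sub_proj_mul, frobSq_eq_sum_col]
  refine Finset.sum_le_sum fun j _ => ?_
  rw [show WithLp.toLp 2 ((A - B).col j) =
    WithLp.toLp 2 (A.col j) - WithLp.toLp 2 (B.col j) from rfl]
  exact pow_le_pow_left₀ (norm_nonneg _)
    (norm_sub_starProjection_le _ _ (toLp_col_mem_colSpan B (Finset.mem_univ j))) 2

theorem Er_le_sum (A : Matrix (Fin m) (Fin n) ℝ) (S : Finset (Fin n)) :
    Er A S ≤ ∑ j ∈ Sᶜ, ∑ i, A i j ^ 2 := by
  rw [Er, frobSq_sub_proj_mul, ← Finset.sum_compl_add_sum S]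
  have h0 : ∑ j ∈ S, ‖WithLp.toLp 2 (A.col j) -
      (colSpan A S).starProjection (WithLp.toLp 2 (A.col j))‖ ^ 2 = 0 := by
    refine Finset.sum_eq_zero fun j hj => ?_
    rw [Submodule.starProjection_eq_self_iff.2 (toLp_col_mem_colSpan A hj)]
    simp
  rw [h0, add_zero]
  refine Finset.sum_le_sum fun j _ => ?_
  have h := norm_sub_starProjection_le (colSpan A S) (WithLp.toLp 2 (A.col j))
    (Submodule.zero_mem _)
  rw [sub_zero] at h
  calc _ ≤ ‖WithLp.toLp 2 (A.col j)‖ ^ 2 := by gcongr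
    _ = _ := by
      rw [EuclideanSpace.norm_sq_eq]
      simp [Matrix.col_apply]

/-- A vector dual to the column `j` bounds the error of any set of columns missing `j`. -/
theorem one_le_dual_mul_Er (A : Matrix (Fin m) (Fin n) ℝ) {S : Finset (Fin n)} {j : Fin n}
    (w : Fin m → ℝ) (hS : ∀ l ∈ S, w ⬝ᵥ A.col l = 0) (hj : w ⬝ᵥ A.col j = 1) :
    1 ≤ (∑ i, w i ^ 2) * Er A S := by
  set W : EuclideanSpace ℝ (Fin m) := WithLp.toLp 2 w with hW
  have inner_W (v : Fin m → ℝ) : inner ℝ W (WithLp.toLp 2 v) = w ⬝ᵥ v := by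
    simp [hW, EuclideanSpace.inner_toLp_toLp, dotProduct_comm]
  have horth : ∀ v ∈ colSpan A S, inner ℝ W v = 0 := by
    intro v hv
    induction hv using Submodule.span_induction with
    | mem x hx =>
      obtain ⟨l, hl, rfl⟩ := hx
      exact (inner_W _).trans (hS l hl)
    | zero => exact inner_zero_right _
    | add x y _ _ hx hy => rw [inner_add_right, hx, hy, add_zero]
    | smul a x _ hx => rw [inner_smul_right, hx, mul_zero]
  set r := WithLp.toLp 2 (A.col j) - (colSpan A S).starProjection (WithLp.toLp 2 (A.col j)) with hr
  -- `W` is orthogonal to the span, so projecting does not change its pairing with column `j`;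
  -- Cauchy–Schwarz then bounds the residual from below.
  have h1 : inner ℝ W r = 1 := by
    rw [hr, inner_sub_right, horth _ (Submodule.starProjection_apply_mem _ _), inner_W, hj, sub_zero]
  have h2 : 1 ≤ ‖W‖ * ‖r‖ := h1 ▸ real_inner_le_norm W r
  have h3 : ‖r‖ ^ 2 ≤ Er A S := by
    rw [Er, frobSq_sub_proj_mul]
    exact Finset.single_le_sum (f := fun j => ‖WithLp.toLp 2 (A.col j) -
      (colSpan A S).starProjection (WithLp.toLp 2 (A.col j))‖ ^ 2)
      (fun _ _ => sq_nonneg _) (Finset.mem_univ j)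
  have h4 : ∑ i, w i ^ 2 = ‖W‖ ^ 2 := by
    rw [EuclideanSpace.norm_sq_eq]
    simp [hW]
  rw [h4]
  calc 1 ≤ (‖W‖ * ‖r‖) ^ 2 := one_le_pow₀ h2
    _ = ‖W‖ ^ 2 * ‖r‖ ^ 2 := mul_pow _ _ _
    _ ≤ _ := by gcongr

/-! ### Eckart–Young for matrices with orthogonal rows -/

theorem finrank_colSpan_univ (B : Matrix (Fin m) (Fin n) ℝ) :
    Module.finrank ℝ (colSpan B Finset.univ) = B.rank := by
  rw [Matrix.rank_eq_finrank_span_cols]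
  have : colSpan B Finset.univ = (Submodule.span ℝ (Set.range B.col)).map
      (WithLp.linearEquiv 2 ℝ (Fin m → ℝ)).symm.toLinearMap := by
    rw [colSpan, Submodule.map_span, ← Set.range_comp, Finset.coe_univ, Set.image_univ]
    rfl
  rw [this]
  exact LinearEquiv.finrank_map_eq _ _

set_option synthInstance.maxHeartbeats 400000 in
theorem isStarProjection_proj (A : Matrix (Fin m) (Fin n) ℝ) (S : Finset (Fin n)) :
    IsStarProjection (proj A S) :=
  (isStarProjection_starProjection (U := colSpan A S)).map
    (Matrix.toEuclideanCLM (n := Fin m) (𝕜 := ℝ)).symm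

theorem trace_proj (A : Matrix (Fin m) (Fin n) ℝ) (S : Finset (Fin n)) :
    (proj A S).trace = Module.finrank ℝ (colSpan A S) := by
  have h : LinearMap.IsProj (colSpan A S) ((colSpan A S).starProjection.toLinearMap) :=
    ⟨fun x => Submodule.starProjection_apply_mem _ x,
      fun x hx => Submodule.starProjection_eq_self_iff.2 hx⟩
  rw [← h.trace]
  have h2 : (colSpan A S).starProjection.toLinearMap = Matrix.toEuclideanLin (proj A S) := by
    rw [← Matrix.coe_toEuclideanCLM_eq_toEuclideanLin, proj, StarAlgEquiv.apply_symm_apply]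
  rw [h2, Matrix.toEuclideanLin_eq_toLin_orthonormal, Matrix.trace_toLin_eq]

/-- The columns of `1 - P` have squared norms `1 - P l l`. -/
theorem sum_sq_one_sub {P : Matrix (Fin m) (Fin m) ℝ} (hP : IsStarProjection P) (l : Fin m) :
    ∑ i, (1 - P) i l ^ 2 = 1 - P l l := by
  have h : (star (1 - P) * (1 - P)) l l = (1 - P) l l := by
    rw [hP.one_sub.isSelfAdjoint.star_eq, hP.one_sub.isIdempotentElem.eq]
  rw [Matrix.sub_apply, Matrix.one_apply_eq] at h
  rw [← h, Matrix.mul_apply]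
  refine Finset.sum_congr rfl fun i _ => ?_
  simp [Matrix.star_apply, sq]

theorem diag_nonneg {P : Matrix (Fin m) (Fin m) ℝ} (hP : IsStarProjection P) (l : Fin m) :
    0 ≤ P l l := by
  have h := sum_sq_one_sub hP.one_sub l
  simp only [sub_sub_cancel, Matrix.sub_apply 1 P, Matrix.one_apply_eq] at h
  rw [← h]
  positivity

theorem diag_le_one {P : Matrix (Fin m) (Fin m) ℝ} (hP : IsStarProjection P) (l : Fin m) :
    P l l ≤ 1 := by
  have h := sum_sq_one_sub hP l
  have h' : 0 ≤ ∑ i, (1 - P) i l ^ 2 := by positivity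
  linarith

theorem frobSq_eq_trace (A : Matrix (Fin m) (Fin n) ℝ) : frobSq A = (A * Aᵀ).trace := by
  rw [frobSq_eq_sum, Matrix.trace]
  refine Finset.sum_congr rfl fun i _ => ?_
  simp [Matrix.mul_apply, sq]

theorem frobSq_mul (R : Matrix (Fin m) (Fin m) ℝ) {A : Matrix (Fin m) (Fin n) ℝ} {d : Fin m → ℝ}
    (hA : A * Aᵀ = diagonal d) : frobSq (R * A) = ∑ l, d l * ∑ i, R i l ^ 2 := by
  rw [frobSq_eq_trace, Matrix.transpose_mul, Matrix.mul_assoc, ← Matrix.mul_assoc A, hA,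
    Matrix.trace]
  have hX (l i : Fin m) : (diagonal d * Rᵀ) l i = d l * R i l := Matrix.diagonal_mul _ _ _ _
  simp only [Matrix.diag_apply, Matrix.mul_apply (M := R), hX, Finset.mul_sum]
  rw [Finset.sum_comm]
  exact Finset.sum_congr rfl fun _ _ => Finset.sum_congr rfl fun _ _ => by ring

/-- The Eckart–Young lower bound for a matrix with orthogonal rows. -/
theorem sum_le_frobSq_sub {A B : Matrix (Fin m) (Fin n) ℝ} {d : Fin m → ℝ}
    (hA : A * Aᵀ = diagonal d) {τ : ℝ} (hB : B.rank = (Finset.univ.filter (τ < d ·)).card) :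
    ∑ i with d i ≤ τ, d i ≤ frobSq (A - B) := by
  refine le_trans ?_ (frobSq_sub_proj_mul_le A B)
  have hP := isStarProjection_proj B Finset.univ
  have htr := trace_proj B Finset.univ
  set P := proj B Finset.univ
  rw [finrank_colSpan_univ, hB, Matrix.trace] at htr
  have : A - P * A = (1 - P) * A := by rw [Matrix.sub_mul, Matrix.one_mul]
  rw [this, frobSq_mul _ hA]
  simp only [sum_sq_one_sub hP]
  have hc : ((Finset.univ.filter (τ < d ·)).card : ℝ) = ∑ i, if τ < d i then 1 else 0 := by simp
  -- Pointwise from `0 ≤ P i i ≤ 1`. On summation the `τ` terms cancel, as the trace of `P` is the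
  -- number of `d i` above `τ`.
  have key : ∀ i, (if d i ≤ τ then d i else 0) ≤
      d i * (1 - P i i) + τ * (P i i - if τ < d i then 1 else 0) := by
    intro i
    have h0 := diag_nonneg hP i
    have h1 := diag_le_one hP i
    split_ifs with h2 h3 h3 <;> nlinarith
  rw [Finset.sum_filter]
  refine (Finset.sum_le_sum fun i _ => key i).trans ?_
  rw [Finset.sum_add_distrib, ← Finset.mul_sum, Finset.sum_sub_distrib, ← hc, ← htr]
  simp

theorem OPT_eq_sum {A : Matrix (Fin m) (Fin n) ℝ} {d : Fin m → ℝ}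
    (hA : A * Aᵀ = diagonal d) {τ : ℝ} (hτ : 0 ≤ τ) :
    OPT A (Finset.univ.filter (τ < d ·)).card = ∑ i with d i ≤ τ, d i := by
  refine IsLeast.csInf_eq ⟨?_, ?_⟩
  · refine ⟨diagonal (fun i => if τ < d i then (1 : ℝ) else 0) * A, ?_, ?_⟩
    · rw [Set.mem_ofPred_eq, ← Matrix.rank_self_mul_transpose, Matrix.transpose_mul,
        Matrix.mul_assoc, ← Matrix.mul_assoc A, hA, Matrix.diagonal_transpose,
        Matrix.diagonal_mul_diagonal, Matrix.diagonal_mul_diagonal, Matrix.rank_diagonal,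
        Fintype.card_subtype]
      congr 1
      ext i
      simp only [Finset.mem_filter, Finset.mem_univ, true_and]
      split_ifs with h
      · simpa [h] using (hτ.trans_lt h).ne'
      · simpa using h
    · have : A - diagonal (fun i => if τ < d i then (1 : ℝ) else 0) * A =
          diagonal (fun i => if d i ≤ τ then (1 : ℝ) else 0) * A := by
        ext i j
        simp only [Matrix.sub_apply, Matrix.diagonal_mul]
        split_ifs with h1 h2 h2
        · exact absurd h1 h2.not_gt
        · simp
        · simp
        · exact absurd (not_lt.1 h1) h2
      simp only [this, frobSq_mul _ hA]
      rw [Finset.sum_filter]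
      refine Finset.sum_congr rfl fun l _ => ?_
      rw [Finset.sum_eq_single l]
      · simp
      · intro i _ hi
        simp [Matrix.diagonal_apply_ne _ hi]
      · simp
  · rintro _ ⟨B, hB, rfl⟩
    exact sum_le_frobSq_sub hA hB

/-- The error of a set of columns missing `j`, for a matrix with orthonormal rows rescaled. -/
theorem one_le_sum_div_mul_Er {U : Matrix (Fin n) (Fin n) ℝ} (hU : U * Uᵀ = 1) {d : Fin n → ℝ}
    (hd : ∀ i, 0 < d i) {S : Finset (Fin n)} {j : Fin n} (hj : j ∉ S) :
    1 ≤ (∑ i, U i j ^ 2 / d i) * Er (diagonal (fun i => √(d i)) * U) S := by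
  have hU' : Uᵀ * U = 1 := mul_eq_one_comm.1 hU
  -- The dual vector is column `j` of the inverse transpose of the scaled matrix.
  have hw (l : Fin n) : (fun i => U i j / √(d i)) ⬝ᵥ (diagonal (fun i => √(d i)) * U).col l =
      (1 : Matrix (Fin n) (Fin n) ℝ) j l := by
    rw [← hU', Matrix.mul_apply, dotProduct]
    refine Finset.sum_congr rfl fun i _ => ?_
    have := (Real.sqrt_pos.2 (hd i)).ne'
    simp only [Matrix.col_apply, Matrix.diagonal_mul, Matrix.transpose_apply]
    field_simp
  have h := one_le_dual_mul_Er (diagonal (fun i => √(d i)) * U) (S := S) (j := j)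
    (fun i => U i j / √(d i))
    (fun l hl => by rw [hw, Matrix.one_apply_ne (by rintro rfl; exact hj hl)])
    (by rw [hw, Matrix.one_apply_eq])
  simpa only [div_pow, Real.sq_sqrt (hd _).le] using h

/-! ### Orthogonal blocks with a constant row -/

theorem exists_orthogonal_constant_row {n : ℕ} (hn : 0 < n) :
    ∃ Q : Matrix (Fin n) (Fin n) ℝ, Q * Qᵀ = 1 ∧ ∀ j, Q ⟨0, hn⟩ j ^ 2 = 1 / n := by
  have hn' : (0 : ℝ) < n := Nat.cast_pos.2 hn
  let u : EuclideanSpace ℝ (Fin n) := WithLp.toLp 2 fun _ => √(1 / n)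
  have hu : ‖u‖ = 1 := by
    have : ‖u‖ ^ 2 = 1 := by
      rw [EuclideanSpace.norm_sq_eq]
      simp only [u, Real.norm_eq_abs, sq_abs, Real.sq_sqrt (one_div_nonneg.2 hn'.le)]
      simp [hn'.ne']
    nlinarith [norm_nonneg u]
  have ho : Orthonormal ℝ (({⟨0, hn⟩} : Set (Fin n)).domRestrict fun _ => u) :=
    ⟨fun _ => hu, fun i j hij => (hij (Subsingleton.elim i j)).elim⟩
  obtain ⟨b, hb⟩ := ho.exists_orthonormalBasis_extension_of_card_eq (by simp)
  refine ⟨Matrix.of fun i j => b i j, ?_, fun j => ?_⟩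
  · ext i j
    have h := orthonormal_iff_ite.1 b.orthonormal j i
    rw [PiLp.inner_apply] at h
    rw [Matrix.mul_apply, Matrix.one_apply]
    simp only [RCLike.inner_apply, conj_trivial] at h
    simpa [eq_comm] using h
  · simp only [Matrix.of_apply, hb _ (Set.mem_singleton _), u]
    rw [Real.sq_sqrt (one_div_nonneg.2 hn'.le)]

/-- An orthogonal matrix with diagonal blocks of sizes `s 0, …, s (T - 1)`, each with one
special row whose entries all have the same absolute value. -/
structure OrthogonalBlocks (T : ℕ) (s : ℕ → ℕ) (N : ℕ) where
  /-- The matrix. -/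
  U : Matrix (Fin N) (Fin N) ℝ
  /-- The index of the block of a row or column. -/
  block : Fin N → ℕ
  /-- The special rows. -/
  special : Finset (Fin N)
  mul_transpose : U * Uᵀ = 1
  eq_zero : ∀ i j, block i ≠ block j → U i j = 0
  sq_eq : ∀ i j, i ∈ special → block i = block j → U i j ^ 2 = 1 / s (block j)
  block_lt : ∀ i, block i < T
  card_block : ∀ b < T, (Finset.univ.filter (block · = b)).card = s b
  card_special : ∀ b < T, (Finset.univ.filter fun i => block i = b ∧ i ∈ special).card = 1

theorem exists_orthogonalBlocks (T : ℕ) {s : ℕ → ℕ} (hs : ∀ b, 0 < s b) :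
    ∃ N, Nonempty (OrthogonalBlocks T s N) := by
  classical
  choose Q hQ hQ0 using fun b => exists_orthogonal_constant_row (hs b)
  let e := Fintype.equivFin (Σ b : Fin T, Fin (s b))
  let V : Matrix (Σ b : Fin T, Fin (s b)) (Σ b : Fin T, Fin (s b)) ℝ :=
    Matrix.blockDiagonal' fun b : Fin T => Q b
  have hV : V * Vᵀ = 1 := by
    rw [Matrix.blockDiagonal'_transpose, ← Matrix.blockDiagonal'_mul]
    simp only [hQ]
    exact Matrix.blockDiagonal'_one
  refine ⟨_, ⟨⟨V.submatrix e.symm e.symm, fun i => (e.symm i).1,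
    Finset.univ.filter fun i => (e.symm i).2.val = 0, ?_, ?_, ?_, ?_, ?_, ?_⟩⟩⟩
  · rw [Matrix.transpose_submatrix, Matrix.submatrix_mul_equiv, hV, Matrix.submatrix_one_equiv]
  · intro i j h
    exact Matrix.blockDiagonal'_apply_ne (fun b : Fin T => Q b) _ _
      fun h' => h (congrArg Fin.val h')
  · intro i j hi hij
    replace hi := (Finset.mem_filter.1 hi).2
    rw [Matrix.submatrix_apply]
    generalize e.symm i = x at *
    generalize e.symm j = y at *
    obtain ⟨b, r⟩ := x
    obtain ⟨c, r'⟩ := y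
    obtain rfl : b = c := Fin.ext hij
    obtain rfl : r = ⟨0, hs b⟩ := Fin.ext hi
    simp only [V, Matrix.blockDiagonal'_apply_eq]
    exact hQ0 _ _
  · exact fun i => (e.symm i).1.2
  · intro b hb
    have hinj : Function.Injective fun r : Fin (s b) => e ⟨⟨b, hb⟩, r⟩ :=
      fun r r' h => by simpa using h
    have : (Finset.univ.filter fun i => ((e.symm i).1 : ℕ) = b) =
        (Finset.univ : Finset (Fin (s b))).image fun r => e ⟨⟨b, hb⟩, r⟩ := by
      ext i
      simp only [Finset.mem_filter, Finset.mem_univ, true_and, Finset.mem_image]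
      constructor
      · intro h
        obtain ⟨x, rfl⟩ := e.surjective i
        obtain ⟨c, r⟩ := x
        rw [Equiv.symm_apply_apply] at h
        subst h
        exact ⟨r, rfl⟩
      · rintro ⟨r, rfl⟩
        simp
    rw [this, Finset.card_image_of_injective _ hinj, Finset.card_univ, Fintype.card_fin]
  · intro b hb
    rw [Finset.card_eq_one]
    refine ⟨e ⟨⟨b, hb⟩, ⟨0, hs b⟩⟩, ?_⟩
    ext i
    simp only [Finset.mem_filter, Finset.mem_univ, true_and, Finset.mem_singleton]
    constructor
    · intro h
      obtain ⟨x, rfl⟩ := e.surjective i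
      obtain ⟨c, r⟩ := x
      rw [Equiv.symm_apply_apply] at h
      obtain ⟨h1, h2⟩ := h
      subst h1
      congr 2
      exact Fin.ext h2
    · rintro rfl
      rw [Equiv.symm_apply_apply]
      exact ⟨rfl, rfl⟩

/-! ### Optimum and column error of the scaled matrix -/

namespace OrthogonalBlocks

variable {T N : ℕ} {s : ℕ → ℕ} (O : OrthogonalBlocks T s N) {c : ℕ} {η : ℝ}

/-- The exponent of the squared singular value attached to a row. -/
def exponent (i : Fin N) : ℕ := 2 * O.block i + if i ∈ O.special then 1 else 0

/-- The block orthogonal matrix with rows rescaled to squared norms `η ^ exponent`. -/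
def scaled (η : ℝ) : Matrix (Fin N) (Fin N) ℝ :=
  diagonal (fun i => √(η ^ O.exponent i)) * O.U

theorem sum_row_sq (i : Fin N) : ∑ j, O.U i j ^ 2 = 1 := by
  have h := congrFun (congrFun O.mul_transpose i) i
  rw [Matrix.mul_apply, Matrix.one_apply_eq] at h
  simpa [sq] using h

theorem sum_col_sq (j : Fin N) : ∑ i, O.U i j ^ 2 = 1 := by
  have h := congrFun (congrFun (mul_eq_one_comm (a := O.U).1 O.mul_transpose) j) j
  rw [Matrix.mul_apply, Matrix.one_apply_eq] at h
  simpa [sq] using h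

theorem scaled_mul_transpose (hη : 0 < η) :
    O.scaled η * (O.scaled η)ᵀ = diagonal fun i => η ^ O.exponent i := by
  rw [scaled, Matrix.transpose_mul, Matrix.mul_assoc, ← Matrix.mul_assoc O.U, O.mul_transpose,
    Matrix.one_mul, Matrix.diagonal_transpose, Matrix.diagonal_mul_diagonal]
  congr 1
  ext i
  exact Real.mul_self_sqrt (pow_pos hη _).le

theorem scaled_sq (hη : 0 < η) (i j : Fin N) :
    O.scaled η i j ^ 2 = η ^ O.exponent i * O.U i j ^ 2 := by
  rw [scaled, Matrix.diagonal_mul, mul_pow, Real.sq_sqrt (pow_pos hη _).le]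

theorem card_block_lt (hc : c ≤ T) :
    (Finset.univ.filter (O.block · < c)).card = ∑ b ∈ Finset.range c, s b := by
  rw [Finset.card_eq_sum_card_fiberwise (f := O.block) (t := Finset.range c)
    (by intro i hi; simpa using hi)]
  refine Finset.sum_congr rfl fun b hb => ?_
  have hb := Finset.mem_range.1 hb
  rw [← O.card_block b (hb.trans_le hc), Finset.filter_filter]
  congr 1
  ext i
  simp only [Finset.mem_filter, Finset.mem_univ, true_and]
  omega

theorem sum_le (O : OrthogonalBlocks T s N) (hc : c ≤ T) : ∑ b ∈ Finset.range c, s b ≤ N := by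
  rw [← O.card_block_lt hc]
  exact (Finset.card_le_univ _).trans_eq (Fintype.card_fin N)

theorem exponent_lt_iff (i : Fin N) : O.exponent i < 2 * c ↔ O.block i < c := by
  rw [exponent]
  split_ifs <;> omega

/-- The row left out is the special row of block `c`, the only one there with exponent `2c + 1`. -/
theorem card_exponent_lt_odd (hc : c < T) :
    (Finset.univ.filter (O.exponent · < 2 * c + 1)).card =
      ∑ b ∈ Finset.range (c + 1), s b - 1 := by
  have h1 := O.card_block_lt (c := c + 1) hc
  have h2 := O.card_special c hc
  have h3 : Finset.univ.filter (O.exponent · < 2 * c + 1) =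
      Finset.univ.filter (O.block · < c + 1) \
        Finset.univ.filter fun i => O.block i = c ∧ i ∈ O.special := by
    ext i
    simp only [Finset.mem_filter, Finset.mem_univ, true_and, Finset.mem_sdiff]
    rw [exponent]
    split_ifs with h
    · simp only [h, and_true]
      omega
    · simp only [h, and_false, not_false_eq_true, and_true]
      omega
  rw [h3, Finset.card_sdiff_of_subset, h1, h2]
  intro i
  simp only [Finset.mem_filter, Finset.mem_univ, true_and]
  omega

/-- Since `η < 1`, the threshold `η ^ a` turns large squared singular values into small exponents.
-/
theorem OPT_scaled (hη : 0 < η) (hη1 : η < 1) (a : ℕ) :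
    OPT (O.scaled η) (Finset.univ.filter (O.exponent · < a)).card =
      ∑ i with a ≤ O.exponent i, η ^ O.exponent i := by
  have h := OPT_eq_sum (O.scaled_mul_transpose hη) (pow_pos hη a).le
  simpa only [pow_lt_pow_iff_right_of_lt_one₀ hη hη1, pow_le_pow_iff_right_of_lt_one₀ hη hη1]
    using h

theorem exists_special (hc : c < T) : ∃ i, O.block i = c ∧ i ∈ O.special := by
  obtain ⟨i, hi⟩ := Finset.card_pos.1 (by rw [O.card_special c hc]; exact one_pos)
  exact ⟨i, (Finset.mem_filter.1 hi).2⟩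

theorem OPT_scaled_pos (hη : 0 < η) (hη1 : η < 1) (hc : c < T) {a : ℕ} (ha : a ≤ 2 * c + 1) :
    0 < OPT (O.scaled η) (Finset.univ.filter (O.exponent · < a)).card := by
  rw [O.OPT_scaled hη hη1]
  obtain ⟨i, hi, hi'⟩ := O.exists_special hc
  refine Finset.sum_pos (fun i _ => pow_pos hη _) ⟨i, ?_⟩
  rw [Finset.mem_filter, exponent, hi, if_pos hi']
  exact ⟨Finset.mem_univ _, ha⟩

/-- Choosing exactly the columns of the first `c` blocks is optimal. -/
theorem Er_scaled_le (hη : 0 < η) (hη1 : η < 1) :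
    Er (O.scaled η) (Finset.univ.filter (O.block · < c)) ≤
      OPT (O.scaled η) (Finset.univ.filter (O.exponent · < 2 * c)).card := by
  rw [O.OPT_scaled hη hη1]
  refine (Er_le_sum _ _).trans ?_
  rw [Finset.sum_comm, Finset.sum_filter]
  refine Finset.sum_le_sum fun i _ => ?_
  simp only [O.scaled_sq hη, ← Finset.mul_sum]
  split_ifs with h
  · refine mul_le_of_le_one_right (pow_pos hη _).le ?_
    rw [← O.sum_row_sq i]
    exact Finset.sum_le_univ_sum_of_nonneg fun j => sq_nonneg _
  · rw [not_le, exponent_lt_iff] at h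
    rw [Finset.sum_eq_zero, mul_zero]
    intro j hj
    simp only [Finset.mem_compl, Finset.mem_filter, Finset.mem_univ, true_and] at hj
    rw [O.eq_zero i j (by omega), zero_pow two_ne_zero]

theorem sum_special (hc : c < T) (x : ℝ) :
    (∑ i, if O.block i = c ∧ i ∈ O.special then x else 0) = x := by
  rw [← Finset.sum_filter, Finset.sum_const, O.card_special c hc, one_smul]

/-- One special row contributes `η ^ (2c+1)`; each of the at most `N` other rows in the tail is
smaller by a factor `η`. -/
theorem OPT_scaled_odd_le (hη : 0 < η) (hη1 : η < 1) (hc : c < T) :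
    OPT (O.scaled η) (Finset.univ.filter (O.exponent · < 2 * c + 1)).card ≤
      η ^ (2 * c + 1) * (1 + N * η) := by
  rw [O.OPT_scaled hη hη1, Finset.sum_filter]
  have h : ∀ i, (if 2 * c + 1 ≤ O.exponent i then η ^ O.exponent i else 0) ≤
      (if O.block i = c ∧ i ∈ O.special then η ^ (2 * c + 1) else 0) + η ^ (2 * c + 2) := by
    intro i
    have hp := pow_pos hη (2 * c + 2)
    have hq := pow_pos hη (2 * c + 1)
    split_ifs with h1 h2 h2
    · have : O.exponent i = 2 * c + 1 := by simp [exponent, h2]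
      rw [this]
      linarith
    · rw [zero_add]
      refine pow_le_pow_of_le_one hη.le hη1.le ?_
      by_contra h3
      have h4 : O.exponent i = 2 * c + 1 := by omega
      rw [exponent] at h4
      split_ifs at h4 with h5
      · exact h2 ⟨by omega, h5⟩
      · omega
    · positivity
    · positivity
  refine (Finset.sum_le_sum fun i _ => h i).trans ?_
  rw [Finset.sum_add_distrib, O.sum_special hc, Finset.sum_const, Finset.card_univ,
    Fintype.card_fin, nsmul_eq_mul]
  exact le_of_eq (by ring)

/-- Only rows in the block of `j` matter: the special row gives the main term, and the others give
at most `η ^ (-2b)` in total because columns of `U` are unit vectors. -/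
theorem sum_div_le (hs : ∀ b, 0 < s b) (hη : 0 < η) (j : Fin N) :
    ∑ i, O.U i j ^ 2 / η ^ O.exponent i ≤
      (1 + s (O.block j) * η) / (s (O.block j) * η ^ (2 * O.block j + 1)) := by
  have hs' : (0 : ℝ) < s (O.block j) := Nat.cast_pos.2 (hs _)
  have h : ∀ i, O.U i j ^ 2 / η ^ O.exponent i ≤
      (if O.block i = O.block j ∧ i ∈ O.special then
        1 / (s (O.block j) * η ^ (2 * O.block j + 1)) else 0) +
      O.U i j ^ 2 / η ^ (2 * O.block j) := by
    intro i
    have hnn : 0 ≤ O.U i j ^ 2 / η ^ (2 * O.block j) := by positivity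
    by_cases hb : O.block i = O.block j
    · by_cases hi : i ∈ O.special
      · rw [if_pos ⟨hb, hi⟩, exponent, if_pos hi, hb]
        refine le_add_of_le_of_nonneg (le_of_eq ?_) hnn
        rw [O.sq_eq i j hi hb, div_div]
      · rw [if_neg fun h => hi h.2, exponent, if_neg hi, hb, zero_add, add_zero]
    · rw [if_neg fun h => hb h.1, O.eq_zero i j hb]
      simp
  refine (Finset.sum_le_sum fun i _ => h i).trans ?_
  rw [Finset.sum_add_distrib, O.sum_special (O.block_lt j), ← Finset.sum_div, O.sum_col_sq]
  refine le_of_eq ?_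
  rw [pow_succ]
  field_simp

theorem le_Er_scaled (hs : ∀ b, 0 < s b) (hη : 0 < η) (hNη : N * η ≤ 1) (hη1 : η < 1)
    (hc : c < T) {S : Finset (Fin N)} (hS : S.card = ∑ b ∈ Finset.range (c + 1), s b - 1) :
    s c * η ^ (2 * c + 1) / (1 + N * η) ≤ Er (O.scaled η) S := by
  have hsN : ∀ b < T, (s b : ℝ) ≤ N := fun b hb => by
    rw [← O.card_block b hb]
    exact_mod_cast (Finset.card_le_univ _).trans_eq (Fintype.card_fin N)
  obtain ⟨j, hj, hjS⟩ : ∃ j ∈ Finset.univ.filter (O.block · < c + 1), j ∉ S := by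
    refine Finset.exists_mem_notMem_of_card_lt_card ?_
    rw [hS, O.card_block_lt hc, Finset.sum_range_succ]
    have := hs c
    omega
  have hjc : O.block j < c + 1 := (Finset.mem_filter.1 hj).2
  have h1 := one_le_sum_div_mul_Er O.mul_transpose (fun i => pow_pos hη (O.exponent i)) hjS
  have hE : 0 ≤ Er (O.scaled η) S := frobSq_nonneg _
  have hb : (0 : ℝ) < s (O.block j) := Nat.cast_pos.2 (hs _)
  have hbN := hsN _ (O.block_lt j)
  have h2 := h1.trans (mul_le_mul_of_nonneg_right (O.sum_div_le hs hη j) hE)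
  rw [div_mul_eq_mul_div, one_le_div (by positivity)] at h2
  -- A missed column in an earlier block costs even more: the extra power of `η` absorbs `s c ≤ N`.
  have h3 : s c * η ^ (2 * c + 1) ≤ s (O.block j) * η ^ (2 * O.block j + 1) := by
    rcases Nat.lt_succ_iff_lt_or_eq.1 hjc with h | h
    · have h4 : (s c : ℝ) * η ≤ 1 := (mul_le_mul_of_nonneg_right (hsN c hc) hη.le).trans hNη
      have h5 : (1 : ℝ) ≤ s (O.block j) := by exact_mod_cast hs _
      calc s c * η ^ (2 * c + 1) = (s c * η) * η ^ (2 * c) := by ring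
        _ ≤ 1 * η ^ (2 * O.block j + 1) :=
          mul_le_mul h4 (pow_le_pow_of_le_one hη.le hη1.le (by omega)) (by positivity) zero_le_one
        _ ≤ _ := by gcongr
    · rw [h]
  rw [div_le_iff₀ (by positivity)]
  refine h3.trans (h2.trans ?_)
  rw [mul_comm]
  gcongr
  exact le_rfl

end OrthogonalBlocks

/-! ### Choice of parameters -/

theorem two_div_sub_geom_sum_le {δ : ℝ} (hδ0 : 0 < δ) {M : ℕ} (hM : 2 / δ ≤ M) (c : ℕ) :
    (1 - δ / 2) * ((∑ b ∈ Finset.range (c + 1), M ^ b : ℕ) : ℝ) ≤ (M : ℝ) ^ c := by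
  have h := geom_sum_mul (M : ℝ) (c + 1)
  have h2 : 2 ≤ M * δ := (div_le_iff₀ hδ0).1 hM
  push_cast
  have hG : 0 ≤ ∑ b ∈ Finset.range (c + 1), (M : ℝ) ^ b := by positivity
  have hM0 : (0 : ℝ) < M := lt_of_lt_of_le (by positivity) hM
  set G := ∑ b ∈ Finset.range (c + 1), (M : ℝ) ^ b
  -- `M * δ ≥ 2` gives `M * (1 - δ / 2) ≤ M - 1`, and `G * (M - 1) = M ^ (c + 1) - 1`.
  refine le_of_mul_le_mul_left ?_ hM0
  rw [pow_succ] at h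
  nlinarith

end CSSP

end
theorem corollary1 (t : ℕ) (δ : ℝ) (hδ0 : 0 < δ) (hδ1 : δ < 1) :
    ∃ (kl ku : Fin t → ℕ) (m n : ℕ) (A : Matrix (Fin m) (Fin n) ℝ),
      (∀ i, 0 < kl i ∧ kl i < ku i) ∧
      (∀ i j, i < j → ku i < kl j) ∧
      (∀ i, ku i ≤ n ∧ 0 < CSSP.OPT A (kl i) ∧ 0 < CSSP.OPT A (ku i)) ∧
      (∀ i,
        (∃ S : Finset (Fin n), S.card = kl i ∧ CSSP.Er A S / CSSP.OPT A (kl i) ≤ 1 + δ) ∧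
        (∀ S : Finset (Fin n), S.card = ku i →
          (1 - δ) * ((ku i : ℝ) + 1) ≤ CSSP.Er A S / CSSP.OPT A (ku i))) := by
  obtain ⟨M, hM⟩ := exists_nat_ge (2 / δ)
  have hM2 : 2 ≤ M := by
    have : (2 : ℝ) ≤ 2 / δ := by
      rw [le_div_iff₀ hδ0]
      linarith
    exact_mod_cast this.trans hM
  have hs : ∀ b, 0 < M ^ b := fun b => pow_pos (by omega) b
  set K : ℕ → ℕ := fun c => ∑ b ∈ Finset.range c, M ^ b with hK
  have hKs : ∀ c, K (c + 1) = K c + M ^ c := fun c => Finset.sum_range_succ _ c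
  have hKmono : Monotone K := monotone_nat_of_le_succ fun c => by rw [hKs]; omega
  have hK1 : K 1 = 1 := by simp [hK]
  -- Pair `i` uses `c = i + 1`; the extra block `0`, of size one, makes the first good rank
  -- positive.
  obtain ⟨N, ⟨O⟩⟩ := CSSP.exists_orthogonalBlocks (t + 1) hs
  have hN : 0 < N := by
    have h1 : K 1 ≤ N := O.sum_le (by omega)
    omega
  have hN' : (0 : ℝ) < N := Nat.cast_pos.2 hN
  have hN1 : (1 : ℝ) ≤ N := by exact_mod_cast hN
  -- With `N * η = δ / 4`, the bounds on `Er` and `OPT` lose a factor `1 + δ / 4` each, and `M`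
  -- loses `1 - δ / 2`; together they stay within `1 - δ`.
  obtain ⟨η, hη⟩ : ∃ η, η = δ / 4 / N := ⟨_, rfl⟩
  have hη0 : 0 < η := by rw [hη]; positivity
  have hNη : N * η = δ / 4 := by rw [hη]; field_simp
  have hη1 : η < 1 := by nlinarith
  have hkl (i : Fin t) : K (i + 1) =
      (Finset.univ.filter (O.exponent · < 2 * (i + 1))).card := by
    simp only [O.exponent_lt_iff]
    exact (O.card_block_lt (by omega)).symm
  have hku (i : Fin t) : K (i + 2) - 1 =
      (Finset.univ.filter (O.exponent · < 2 * (i + 1) + 1)).card :=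
    (O.card_exponent_lt_odd (by omega)).symm
  have hlpos (i : Fin t) : 0 < CSSP.OPT (O.scaled η) (K (i + 1)) := by
    rw [hkl]
    exact O.OPT_scaled_pos hη0 hη1 (c := i + 1) (by omega) (by omega)
  have hupos (i : Fin t) : 0 < CSSP.OPT (O.scaled η) (K (i + 2) - 1) := by
    rw [hku]
    exact O.OPT_scaled_pos hη0 hη1 (c := i + 1) (by omega) (by omega)
  refine ⟨fun i => K (i + 1), fun i => K (i + 2) - 1, N, N, O.scaled η, fun i => ⟨?_, ?_⟩,
    fun i j hij => ?_, fun i => ⟨?_, hlpos i, hupos i⟩, fun i => ⟨?_, fun S hS => ?_⟩⟩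
  · have h1 : K 1 ≤ K (i + 1) := hKmono (by omega)
    show 0 < K (i + 1)
    omega
  · have h1 := hKs (i + 1)
    have h2 : M ^ 1 ≤ M ^ ((i : ℕ) + 1) := Nat.pow_le_pow_right (by omega) (by omega)
    have h3 : 2 ≤ M ^ ((i : ℕ) + 1) := hM2.trans ((pow_one M).symm.trans_le h2)
    show K (i + 1) < K (i + 1 + 1) - 1
    generalize M ^ ((i : ℕ) + 1) = p at h1 h3
    omega
  · have h1 : K (i + 2) ≤ K (j + 1) := hKmono (by have : (i : ℕ) < j := hij; omega)
    have h2 := hKmono (show 1 ≤ (i : ℕ) + 2 by omega)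
    show K (i + 2) - 1 < K (j + 1)
    omega
  · exact (Nat.sub_le _ _).trans (O.sum_le (by omega))
  · refine ⟨Finset.univ.filter (O.block · < i + 1), O.card_block_lt (by omega), ?_⟩
    rw [div_le_iff₀ (hlpos i)]
    have h := O.Er_scaled_le (c := i + 1) hη0 hη1
    rw [← hkl] at h
    have := hlpos i
    nlinarith
  · have hE := O.le_Er_scaled (c := i + 1) hs hη0 (by rw [hNη]; linarith) hη1 (by omega) hS
    have hO := O.OPT_scaled_odd_le (c := i + 1) hη0 hη1 (by omega)
    rw [← hku] at hO
    rw [hNη] at hE hO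
    have hG := CSSP.two_div_sub_geom_sum_le hδ0 hM (i + 1)
    have hcast : (((K (i + 2) - 1 : ℕ) : ℝ) + 1) = (K (i + 1 + 1) : ℕ) := by
      have h2 := hKmono (show 1 ≤ (i : ℕ) + 2 by omega)
      rw [Nat.cast_sub (by omega)]
      push_cast
      ring
    rw [le_div_iff₀ (hupos i)]
    simp only [hcast]
    change (1 - δ / 2) * ((K (i + 1 + 1) : ℕ) : ℝ) ≤ _ at hG
    refine le_trans ?_ hE
    have hKnn : (0 : ℝ) ≤ (K (i + 1 + 1) : ℕ) := Nat.cast_nonneg _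
    have hp : 0 < η ^ (2 * ((i : ℕ) + 1) + 1) := pow_pos hη0 _
    rw [le_div_iff₀ (by positivity)]
    push_cast
    generalize (K (i + 1 + 1) : ℝ) = k at *
    generalize η ^ (2 * ((i : ℕ) + 1) + 1) = p at *
    generalize (M : ℝ) ^ ((i : ℕ) + 1) = q at *
    have h1 : (1 - δ) * (1 + δ / 4) ^ 2 ≤ 1 - δ / 2 := by nlinarith [mul_pos hδ0 hδ0, pow_pos hδ0 3]
    calc (1 - δ) * k * CSSP.OPT (O.scaled η) (K (i + 2) - 1) * (1 + δ / 4)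
        ≤ (1 - δ) * k * (p * (1 + δ / 4)) * (1 + δ / 4) := by
          have : 0 ≤ 1 - δ := by linarith
          gcongr
      _ = ((1 - δ) * (1 + δ / 4) ^ 2) * k * p := by ring
      _ ≤ (1 - δ / 2) * k * p := by gcongr
      _ ≤ q * p := by gcongr
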